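/- Let $H_1,H_2$ be separable complex Hilbert spaces and let $B(H_1,H_2)$ be the space of bounded linear operators $H_1\to H_2$. For a set $\mathcal S\subseteq B(H_1,H_2)$ let $\operatorname{Ref}\mathcal S$ be the set of all $T\in B(H_1,H_2)$ such that, for every $x\in H_1$, $Tx$ lies in the closed linear span of $\{Sx : S\in\mathcal S\}$. A linear subspace $\mathcal U\subseteq B(H_1,H_2)$ is called strongly reflexive if $\mathcal U=\operatorname{Ref}\mathcal R$ for some set $\mathcal R$ of rank one operators, and normalizing if $AB^*C\in\mathcal U$ for all $A,B,C\in\mathcal U$. For sequences $(E_n)$ and $(F_n)$ of mutually orthogonal projections (possibly zero) on $H_1$ and $H_2$ respectively, let $\bigoplus_n F_nB(H_1,H_2)E_n$ denote the set of all $T\in B(H_1,H_2)$ of the form $T=\sum_n F_nS_nE_n$ with $S_n\in B(H_1,H_2)$, the series converging in the strong operator topology. (i) A strongly reflexive subspace $\mathcal U\subseteq B(H_1,H_2)$ is normalizing if and only if there are sequences $(E_n)$ and $(F_n)$ of mutually orthogonal projections on $H_1$ and $H_2$ respectively such that $\mathcal U=\bigoplus_n F_nB(H_1,H_2)E_n$.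 (ii) If $\mathcal U\subseteq B(H_1,H_2)$ is any normalizing subspace, then the ultraweak closure of the linear span of the rank one operators contained in $\mathcal U$ equals $\bigoplus_n F_nB(H_1,H_2)E_n$ for some sequences $(E_n)$ and $(F_n)$ of mutually orthogonal projections on $H_1$ and $H_2$ respectively. -/

import Mathlib

namespace NormalizingSpaces

open ContinuousLinearMap

variable {H₁ H₂ : Type*}
  [NormedAddCommGroup H₁] [InnerProductSpace ℂ H₁] [CompleteSpace H₁]
  [NormedAddCommGroup H₂] [InnerProductSpace ℂ H₂] [CompleteSpace H₂]

/-- A linear space of operators is normalizing if it is closed under the triple product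
`(A, B, C) ↦ A B* C`. -/
def IsNormalizing (U : Submodule ℂ (H₁ →L[ℂ] H₂)) : Prop :=
  ∀ A ∈ U, ∀ B ∈ U, ∀ C ∈ U, A ∘L (adjoint B) ∘L C ∈ U

/-- Rank one operators: `ξ ↦ ⟨ξ, x⟩ y` with `x ≠ 0` and `y ≠ 0`
(`InnerProductSpace.rankOne ℂ y x` sends `ξ` to `inner ℂ x ξ • y`, and Mathlib's inner product is
conjugate-linear in the first variable). -/
def IsRankOne (R : H₁ →L[ℂ] H₂) : Prop :=
  ∃ (y : H₂) (x : H₁), y ≠ 0 ∧ x ≠ 0 ∧ R = InnerProductSpace.rankOne ℂ y x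

/-- The reflexive hull of a set of operators: all `T` such that, for every `x`, the vector `T x`
lies in the closed linear span of `{S x : S ∈ 𝒮}`. -/
def Ref (𝒮 : Set (H₁ →L[ℂ] H₂)) : Set (H₁ →L[ℂ] H₂) :=
  {T | ∀ x : H₁, T x ∈ (Submodule.span ℂ {v : H₂ | ∃ S ∈ 𝒮, v = S x}).topologicalClosure}

/-- A subspace is strongly reflexive if it is the reflexive hull of a set of rank one operators. -/
def IsStronglyReflexive (U : Submodule ℂ (H₁ →L[ℂ] H₂)) : Prop :=
  ∃ R : Set (H₁ →L[ℂ] H₂), (∀ T ∈ R, IsRankOne T) ∧ (U : Set (H₁ →L[ℂ] H₂)) = Ref R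

/-- The rank one subspace of `U`: the linear span of the rank one operators contained in `U`. -/
def rankOneSubspace (U : Submodule ℂ (H₁ →L[ℂ] H₂)) : Submodule ℂ (H₁ →L[ℂ] H₂) :=
  Submodule.span ℂ {R | R ∈ U ∧ IsRankOne R}

/-- A sequence of mutually orthogonal (self-adjoint) projections. Some of them may be zero, so
finite families are included. -/
def IsOrthogonalProjections {H : Type*} [NormedAddCommGroup H] [InnerProductSpace ℂ H]
    [CompleteSpace H] (P : ℕ → H →L[ℂ] H) : Prop :=
  (∀ n, IsStarProjection (P n)) ∧ Pairwise fun m n => P m * P n = 0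

/-- The direct sum `⊕ₙ Fₙ B(H₁, H₂) Eₙ`: all bounded operators `T` that are sums, in the strong
operator topology, `T = ∑ₙ Fₙ Sₙ Eₙ` with `Sₙ ∈ B(H₁, H₂)`. -/
def blockSum (F : ℕ → H₂ →L[ℂ] H₂) (E : ℕ → H₁ →L[ℂ] H₁) : Set (H₁ →L[ℂ] H₂) :=
  {T | ∃ S : ℕ → H₁ →L[ℂ] H₂, ∀ x : H₁, HasSum (fun n => (F n ∘L S n ∘L E n) x) (T x)}

variable (H₁ H₂) in
/-- The ultraweak (σ-weak) topology on `B(H₁, H₂)`: the coarsest topology making continuous all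
functionals `T ↦ ∑ₙ ⟨T ξₙ, ηₙ⟩` with `∑ₙ ‖ξₙ‖² < ∞` and `∑ₙ ‖ηₙ‖² < ∞`. -/
noncomputable abbrev ultraweakTopology : TopologicalSpace (H₁ →L[ℂ] H₂) :=
  ⨅ (ξ : ℕ → H₁) (η : ℕ → H₂) (_ : Summable fun n => ‖ξ n‖ ^ 2)
    (_ : Summable fun n => ‖η n‖ ^ 2),
    TopologicalSpace.induced (fun T : H₁ →L[ℂ] H₂ => ∑' n, inner ℂ (η n) (T (ξ n))) inferInstance

/-- The closure of a set of operators in the ultraweak topology. -/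
noncomputable def ultraweakClosure (𝒮 : Set (H₁ →L[ℂ] H₂)) : Set (H₁ →L[ℂ] H₂) :=
  @closure _ (ultraweakTopology H₁ H₂) 𝒮

end NormalizingSpaces

/-! Write y⊗x for `rankOne ℂ y x`. If U is normalizing and contains y₁⊗x₁, y₂⊗x₂, y₃⊗x₃, then it
contains ⟨x₁,x₂⟩⟨y₂,y₃⟩ y₁⊗x₃ (`IsNormalizing.rankOne_mem`). Hence for nonzero y the spaces {x : y⊗x
∈ U} are pairwise equal or orthogonal, and so are the matching spaces of y's. Separability leaves
countably many nonzero ones, so the rank one operators of U split into orthogonal blocks X n, Y n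
(`IsNormalizing.exists_isRankOneDecomposition`).

With E n, F n the projections onto the closures of X n, Y n, the inclusions ultraweak closure of the
span ⊆ `Ref` ⊆ `blockSum` ⊆ ultraweak closure make all three sets equal. This gives (ii), and the
forward half of (i), since a strongly reflexive U is the hull of its own rank one operators.
Conversely, the relations F n T = T E n and T = ∑ T E n are inherited by A B* C. -/

namespace NormalizingSpaces

open ContinuousLinearMap Filter Topology InnerProductSpace

set_option linter.unusedSectionVars false

/-! ### Sums of orthogonal projections -/

section Projections

variable {H : Type*} [NormedAddCommGroup H] [InnerProductSpace ℂ H] [CompleteSpace H]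
  {ι : Type*} {P : ι → H →L[ℂ] H}

lemma isStarProjection_finsetSum (hP : ∀ i, IsStarProjection (P i))
    (hPP : Pairwise fun i j => P i * P j = 0) (s : Finset ι) :
    IsStarProjection (∑ i ∈ s, P i) := by
  classical
  induction s using Finset.induction_on with
  | empty => simp
  | insert a s ha ih =>
    rw [Finset.sum_insert ha]
    refine (hP a).add ih ?_
    rw [Finset.mul_sum]
    exact Finset.sum_eq_zero fun i hi => hPP fun h => ha (h ▸ hi)

lemma norm_finsetSum_projections_le (hP : ∀ i, IsStarProjection (P i))
    (hPP : Pairwise fun i j => P i * P j = 0) (s : Finset ι) :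
    ‖∑ i ∈ s, P i‖ ≤ 1 :=
  IsStarProjection.norm_le _ (isStarProjection_finsetSum hP hPP s)

/-- The partial sums are contractions, hence equicontinuous, and pointwise convergence of an
equicontinuous family to a continuous limit is a closed condition. -/
lemma isClosed_setOf_hasSum_projections (hP : ∀ i, IsStarProjection (P i))
    (hPP : Pairwise fun i j => P i * P j = 0) :
    IsClosed {v : H | HasSum (fun i => P i v) v} := by
  have hL : ∀ s : Finset ι, LipschitzWith 1 fun v : H => ∑ i ∈ s, P i v := fun s => by
    have h := (∑ i ∈ s, P i).lipschitz.weaken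
      (show ‖∑ i ∈ s, P i‖₊ ≤ 1 from norm_finsetSum_projections_le hP hPP s)
    rwa [show ⇑(∑ i ∈ s, P i) = fun v => ∑ i ∈ s, P i v by ext; simp] at h
  exact (LipschitzWith.uniformEquicontinuous _ _ hL).equicontinuous.isClosed_setOfPred_tendsto
    continuous_id

end Projections

variable {H₁ H₂ : Type*}
  [NormedAddCommGroup H₁] [InnerProductSpace ℂ H₁] [CompleteSpace H₁]
  [NormedAddCommGroup H₂] [InnerProductSpace ℂ H₂] [CompleteSpace H₂]

/-! ### The ultraweak topology -/

section Ultraweak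

lemma norm_inner_apply_le (T : H₁ →L[ℂ] H₂) (x : H₁) (y : H₂) :
    ‖inner ℂ y (T x)‖ ≤ ‖T‖ * (‖y‖ * ‖x‖) :=
  calc ‖inner ℂ y (T x)‖ ≤ ‖y‖ * ‖T x‖ := norm_inner_le_norm _ _
    _ ≤ ‖y‖ * (‖T‖ * ‖x‖) := by gcongr; exact T.le_opNorm x
    _ = _ := by ring

variable {ξ : ℕ → H₁} {η : ℕ → H₂}

lemma summable_norm_mul_norm (hξ : Summable fun n => ‖ξ n‖ ^ 2)
    (hη : Summable fun n => ‖η n‖ ^ 2) : Summable fun n => ‖η n‖ * ‖ξ n‖ :=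
  (hη.add hξ).of_nonneg_of_le (fun n => by positivity) fun n => by
    nlinarith [sq_nonneg (‖η n‖ - ‖ξ n‖), sq_nonneg (‖η n‖), sq_nonneg (‖ξ n‖)]

lemma summable_inner_apply (hξ : Summable fun n => ‖ξ n‖ ^ 2)
    (hη : Summable fun n => ‖η n‖ ^ 2) (T : H₁ →L[ℂ] H₂) :
    Summable fun n => inner ℂ (η n) (T (ξ n)) :=
  ((summable_norm_mul_norm hξ hη).mul_left ‖T‖).of_norm_bounded
    fun n => norm_inner_apply_le T (ξ n) (η n)

/-- The ultraweakly continuous functional `T ↦ ∑ₙ ⟨T ξₙ, ηₙ⟩`. -/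
noncomputable def vectorFunctional (hξ : Summable fun n => ‖ξ n‖ ^ 2)
    (hη : Summable fun n => ‖η n‖ ^ 2) : (H₁ →L[ℂ] H₂) →L[ℂ] ℂ :=
  LinearMap.mkContinuous
    { toFun := fun T => ∑' n, inner ℂ (η n) (T (ξ n))
      map_add' := fun S T => by
        simp only [add_apply, inner_add_right]
        exact (summable_inner_apply hξ hη S).tsum_add (summable_inner_apply hξ hη T)
      map_smul' := fun c T => by
        simp only [smul_apply, inner_smul_right, tsum_mul_left, RingHom.id_apply, smul_eq_mul] }
    (∑' n, ‖η n‖ * ‖ξ n‖) fun T => by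
      rw [mul_comm]
      exact tsum_of_norm_bounded ((summable_norm_mul_norm hξ hη).hasSum.mul_left ‖T‖)
        fun n => norm_inner_apply_le T (ξ n) (η n)

lemma norm_topology_le_ultraweakTopology :
    (inferInstance : TopologicalSpace (H₁ →L[ℂ] H₂)) ≤ ultraweakTopology H₁ H₂ :=
  le_iInf fun _ => le_iInf fun _ => le_iInf fun hξ => le_iInf fun hη =>
    continuous_iff_le_induced.mp (vectorFunctional hξ hη).continuous

lemma continuousAdd_ultraweakTopology :
    @ContinuousAdd (H₁ →L[ℂ] H₂) (ultraweakTopology H₁ H₂) _ :=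
  continuousAdd_iInf fun _ => continuousAdd_iInf fun _ => continuousAdd_iInf fun hξ =>
    continuousAdd_iInf fun hη =>
      continuousAdd_induced (vectorFunctional hξ hη)

lemma subset_ultraweakClosure (𝒮 : Set (H₁ →L[ℂ] H₂)) : 𝒮 ⊆ ultraweakClosure 𝒮 :=
  @subset_closure _ (ultraweakTopology H₁ H₂) 𝒮

lemma isClosed_ultraweakClosure (𝒮 : Set (H₁ →L[ℂ] H₂)) : IsClosed (ultraweakClosure 𝒮) :=
  (@isClosed_closure _ (ultraweakTopology H₁ H₂) 𝒮).mono norm_topology_le_ultraweakTopology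

lemma sum_mem_ultraweakClosure {V : Submodule ℂ (H₁ →L[ℂ] H₂)} {ι : Type*} (s : Finset ι)
    {T : ι → H₁ →L[ℂ] H₂} (hT : ∀ i ∈ s, T i ∈ ultraweakClosure (V : Set (H₁ →L[ℂ] H₂))) :
    ∑ i ∈ s, T i ∈ ultraweakClosure (V : Set (H₁ →L[ℂ] H₂)) :=
  AddSubmonoid.sum_mem (@AddSubmonoid.topologicalClosure _
    (ultraweakTopology H₁ H₂) _
    (letI := ultraweakTopology H₁ H₂; haveI := continuousAdd_ultraweakTopology (H₁ := H₁) (H₂ := H₂)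
      inferInstance) V.toAddSubmonoid) hT

/-- Bounded nets converging pointwise converge ultraweakly. -/
lemma tendsto_ultraweak {ι : Type*} {l : Filter ι} {A : ι → H₁ →L[ℂ] H₂} {T : H₁ →L[ℂ] H₂}
    {M : ℝ} (hM : ∀ i, ‖A i‖ ≤ M) (hA : ∀ x, Tendsto (fun i => A i x) l (𝓝 (T x))) :
    Tendsto A l (@nhds _ (ultraweakTopology H₁ H₂) T) := by
  simp only [nhds_iInf, nhds_induced, tendsto_iInf, tendsto_comap_iff]
  intro ξ η hξ hη
  refine tendsto_tsum_of_dominated_convergence ((summable_norm_mul_norm hξ hη).mul_left M)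
    (fun n => tendsto_const_nhds.inner (hA (ξ n))) (Eventually.of_forall fun i n => ?_)
  exact (norm_inner_apply_le (A i) (ξ n) (η n)).trans (by gcongr; exact hM i)

/-- The partial sums of ∑ T P i have norm at most ‖T‖, so their strong convergence is also
ultraweak. -/
lemma mem_ultraweakClosure_of_hasSum {V : Submodule ℂ (H₁ →L[ℂ] H₂)} {ι : Type*}
    {P : ι → H₁ →L[ℂ] H₁} (hP : ∀ i, IsStarProjection (P i))
    (hPP : Pairwise fun i j => P i * P j = 0) {T : H₁ →L[ℂ] H₂}
    (hT : ∀ x, HasSum (fun i => T (P i x)) (T x))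
    (hV : ∀ i, T ∘L P i ∈ ultraweakClosure (V : Set (H₁ →L[ℂ] H₂))) :
    T ∈ ultraweakClosure (V : Set (H₁ →L[ℂ] H₂)) := by
  have hlim : Tendsto (fun s : Finset ι => ∑ i ∈ s, T ∘L P i) atTop
      (@nhds _ (ultraweakTopology H₁ H₂) T) := by
    refine tendsto_ultraweak (M := ‖T‖) (fun s => ?_) fun x => ?_
    · rw [← ContinuousLinearMap.comp_finsetSum]
      refine (opNorm_comp_le _ _).trans ?_
      exact mul_le_of_le_one_right (norm_nonneg _) (norm_finsetSum_projections_le hP hPP s)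
    · simpa [HasSum] using hT x
  have h := @mem_closure_of_tendsto _ (ultraweakTopology H₁ H₂) _ _ _ _ _ _ hlim
    (Eventually.of_forall fun s => sum_mem_ultraweakClosure s fun i _ => hV i)
  exact (@closure_closure _ (ultraweakTopology H₁ H₂) _).subset h

lemma summable_norm_single_sq {H : Type*} [NormedAddCommGroup H] (v : H) :
    Summable fun n => ‖(Pi.single 0 v : ℕ → H) n‖ ^ 2 :=
  summable_of_ne_finset_zero (s := {0}) fun n hn => by
    simp [Pi.single_eq_of_ne (show n ≠ 0 by simpa using hn)]

/-- By the double orthogonal complement, the hull is cut out by equations ⟨y, T x⟩ = 0. Each such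
functional is ultraweakly continuous: it comes from sequences supported at index 0. -/
lemma isClosed_ultraweak_Ref (𝒮 : Set (H₁ →L[ℂ] H₂)) :
    @IsClosed _ (ultraweakTopology H₁ H₂) (Ref 𝒮) := by
  have hcont : ∀ (x : H₁) (y : H₂), @Continuous _ _ (ultraweakTopology H₁ H₂) _
      fun T : H₁ →L[ℂ] H₂ => inner ℂ y (T x) := fun x y => by
    have h : ultraweakTopology H₁ H₂ ≤ TopologicalSpace.induced (fun T : H₁ →L[ℂ] H₂ =>
        ∑' n, inner ℂ ((Pi.single 0 y : ℕ → H₂) n) (T ((Pi.single 0 x : ℕ → H₁) n)))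
          inferInstance :=
      iInf_le_of_le (Pi.single 0 x) <| iInf_le_of_le (Pi.single 0 y) <|
        iInf_le_of_le (summable_norm_single_sq x) <|
          iInf_le_of_le (summable_norm_single_sq y) le_rfl
    refine continuous_iff_le_induced.mpr (h.trans (le_of_eq ?_))
    congr 1
    funext T
    rw [tsum_eq_single 0 fun n hn => by simp [Pi.single_eq_of_ne hn]]
    simp
  have : Ref 𝒮 = ⋂ (x : H₁) (y : H₂)
      (_ : y ∈ (Submodule.span ℂ {v : H₂ | ∃ S ∈ 𝒮, v = S x})ᗮ),
      (fun T : H₁ →L[ℂ] H₂ => inner ℂ y (T x)) ⁻¹' {0} := by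
    ext T
    simp only [Ref, Set.mem_ofPred_eq, ← Submodule.orthogonal_orthogonal_eq_closure,
      Submodule.mem_orthogonal, Set.mem_iInter, Set.mem_preimage, Set.mem_singleton_iff]
  rw [this]
  refine @isClosed_iInter _ _ (ultraweakTopology H₁ H₂) _ fun x =>
    @isClosed_iInter _ _ (ultraweakTopology H₁ H₂) _ fun y =>
    @isClosed_iInter _ _ (ultraweakTopology H₁ H₂) _ fun _ => ?_
  exact @IsClosed.preimage _ _ (ultraweakTopology H₁ H₂) _ _ (hcont x y) _ isClosed_singleton

end Ultraweak

/-! ### The reflexive hull -/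

section Ref

lemma subset_Ref (𝒮 : Set (H₁ →L[ℂ] H₂)) : 𝒮 ⊆ Ref 𝒮 := fun S hS _ =>
  Submodule.le_topologicalClosure _ (Submodule.subset_span ⟨S, hS, rfl⟩)

lemma Ref_mono {𝒮 𝒯 : Set (H₁ →L[ℂ] H₂)} (h : 𝒮 ⊆ 𝒯) : Ref 𝒮 ⊆ Ref 𝒯 := fun _ hT x =>
  Submodule.topologicalClosure_mono
    (Submodule.span_mono (by rintro _ ⟨S, hS, rfl⟩; exact ⟨S, h hS, rfl⟩)) (hT x)

lemma Ref_subset_Ref_of_subset {𝒮 𝒯 : Set (H₁ →L[ℂ] H₂)} (h : 𝒮 ⊆ Ref 𝒯) :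
    Ref 𝒮 ⊆ Ref 𝒯 := fun _ hT x => by
  refine Submodule.topologicalClosure_minimal _ (Submodule.span_le.mpr ?_)
    (Submodule.isClosed_topologicalClosure _) (hT x)
  rintro _ ⟨S, hS, rfl⟩
  exact h hS x

lemma span_subset_Ref (𝒮 : Set (H₁ →L[ℂ] H₂)) :
    (Submodule.span ℂ 𝒮 : Set (H₁ →L[ℂ] H₂)) ⊆ Ref 𝒮 := fun T hT x => by
  induction hT using Submodule.span_induction with
  | mem S hS => exact subset_Ref 𝒮 hS x
  | zero => simp
  | add S T _ _ hS hT => exact add_mem hS hT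
  | smul c T _ hT => exact Submodule.smul_mem _ c hT

lemma ultraweakClosure_span_subset_Ref (𝒮 : Set (H₁ →L[ℂ] H₂)) :
    ultraweakClosure (Submodule.span ℂ 𝒮 : Set (H₁ →L[ℂ] H₂)) ⊆ Ref 𝒮 :=
  @closure_minimal _ (ultraweakTopology H₁ H₂) _ _ (span_subset_Ref 𝒮) (isClosed_ultraweak_Ref 𝒮)

end Ref

/-! ### Block sums and the intertwining relation -/

section BlockSum

variable {E : ℕ → H₁ →L[ℂ] H₁} {F : ℕ → H₂ →L[ℂ] H₂}

/-- By orthogonality both sides collapse to the single term F n S n E n. -/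
lemma comp_eq_comp_of_mem_blockSum (hE : IsOrthogonalProjections E)
    (hF : IsOrthogonalProjections F) {T : H₁ →L[ℂ] H₂} (hT : T ∈ blockSum F E) (n : ℕ) :
    F n ∘L T = T ∘L E n := by
  obtain ⟨S, hS⟩ := hT
  have hFF : ∀ m k z, F m (F k z) = if m = k then F m z else 0 := fun m k z => by
    split_ifs with h
    · subst h
      exact DFunLike.congr_fun (hF.1 m).isIdempotentElem z
    · exact DFunLike.congr_fun (hF.2 h) z
  have hEE : ∀ m k z, E m (E k z) = if m = k then E m z else 0 := fun m k z => by
    split_ifs with h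
    · subst h
      exact DFunLike.congr_fun (hE.1 m).isIdempotentElem z
    · exact DFunLike.congr_fun (hE.2 h) z
  ext x
  have h1 : HasSum (fun m => F n (F m (S m (E m x)))) (F n (T x)) := (hS x).mapL (F n)
  have h2 : HasSum (fun m => F m (S m (E m (E n x)))) (T (E n x)) := hS (E n x)
  have h3 : ∀ m ≠ n, F n (F m (S m (E m x))) = 0 := fun m hm => by rw [hFF, if_neg hm.symm]
  have h4 : ∀ m ≠ n, F m (S m (E m (E n x))) = 0 := fun m hm => by
    rw [hEE, if_neg hm, map_zero, map_zero]
  have h5 := h1.unique (hasSum_single n h3)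
  have h6 := h2.unique (hasSum_single n h4)
  rw [hFF, if_pos rfl] at h5
  rw [hEE, if_pos rfl] at h6
  exact h5.trans h6.symm

lemma hasSum_of_mem_blockSum (hE : IsOrthogonalProjections E)
    (hF : IsOrthogonalProjections F) {T : H₁ →L[ℂ] H₂} (hT : T ∈ blockSum F E) (x : H₁) :
    HasSum (fun n => T (E n x)) (T x) := by
  have h := fun n => comp_eq_comp_of_mem_blockSum hE hF hT n
  obtain ⟨S, hS⟩ := hT
  have hn : ∀ n, F n (S n (E n x)) = T (E n x) := fun n => by
    have h1 : T (E n x) = _ := (hS (E n x)).unique (hasSum_single n fun m hm => by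
      have : E m (E n x) = 0 := DFunLike.congr_fun (hE.2 hm) x
      simp [this])
    have h2 : E n (E n x) = E n x := DFunLike.congr_fun (hE.1 n).isIdempotentElem x
    simpa [h2] using h1.symm
  simpa [hn] using hS x

lemma mem_blockSum_of_hasSum {T : H₁ →L[ℂ] H₂} (hFE : ∀ n, F n ∘L T = T ∘L E n)
    (hF : IsOrthogonalProjections F) (hT : ∀ x, HasSum (fun n => F n (T x)) (T x)) :
    T ∈ blockSum F E := by
  -- The constant sequence S n = T works, since F n T E n = F n F n T = F n T.
  refine ⟨fun _ => T, fun x => ?_⟩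
  convert hT x using 2 with n
  have h1 : T (E n x) = F n (T x) := (DFunLike.congr_fun (hFE n) x).symm
  have h2 : F n (F n (T x)) = F n (T x) := DFunLike.congr_fun (hF.1 n).isIdempotentElem (T x)
  simp [h1, h2]

lemma isNormalizing_of_eq_blockSum {U : Submodule ℂ (H₁ →L[ℂ] H₂)}
    (hE : IsOrthogonalProjections E) (hF : IsOrthogonalProjections F)
    (hU : (U : Set (H₁ →L[ℂ] H₂)) = blockSum F E) : IsNormalizing U := by
  intro A hA B hB C hC
  rw [← SetLike.mem_coe, hU] at hA hB hC ⊢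
  have hA' := comp_eq_comp_of_mem_blockSum hE hF hA
  have hC' := comp_eq_comp_of_mem_blockSum hE hF hC
  have hB' : ∀ n, adjoint B ∘L F n = E n ∘L adjoint B := fun n => by
    have h := congrArg adjoint (comp_eq_comp_of_mem_blockSum hE hF hB n)
    rwa [adjoint_comp, adjoint_comp, (isSelfAdjoint_iff'.mp (hF.1 n).isSelfAdjoint),
      (isSelfAdjoint_iff'.mp (hE.1 n).isSelfAdjoint)] at h
  have hABC : ∀ n, F n ∘L A ∘L adjoint B ∘L C = (A ∘L adjoint B ∘L C) ∘L E n := fun n => by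
    rw [comp_assoc, comp_assoc, ← hC', ← comp_assoc (adjoint B), hB', ← comp_assoc (F n), hA']
    rfl
  refine mem_blockSum_of_hasSum hABC hF fun x => ?_
  have h := (hasSum_of_mem_blockSum hE hF hC x).mapL (A ∘L adjoint B)
  change HasSum _ ((A ∘L adjoint B) (C x))
  convert h using 2 with n
  exact DFunLike.congr_fun (hABC n) x

end BlockSum

/-! ### From orthogonal blocks to the closure and the hull -/

section Decomposition

/-- Pairwise orthogonal sequences of subspaces `X n`, `Y n` such that the rank one operators in `U`
are exactly the nonzero operators `rankOne ℂ y x` with `x ∈ X n` and `y ∈ Y n` for some `n`. -/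
structure IsRankOneDecomposition (U : Submodule ℂ (H₁ →L[ℂ] H₂))
    (X : ℕ → Submodule ℂ H₁) (Y : ℕ → Submodule ℂ H₂) : Prop where
  orthoX : Pairwise fun m n => X m ⟂ X n
  orthoY : Pairwise fun m n => Y m ⟂ Y n
  rankOne_mem : ∀ n, ∀ x ∈ X n, ∀ y ∈ Y n, rankOne ℂ y x ∈ U
  exists_mem : ∀ x y, x ≠ 0 → y ≠ 0 → rankOne ℂ y x ∈ U → ∃ n, x ∈ X n ∧ y ∈ Y n

/-- The orthogonal projections onto the closures of a sequence of subspaces. -/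
noncomputable def closureProjection {H : Type*} [NormedAddCommGroup H] [InnerProductSpace ℂ H]
    [CompleteSpace H] (X : ℕ → Submodule ℂ H) (n : ℕ) : H →L[ℂ] H :=
  (X n).topologicalClosure.starProjection

lemma isOrthogonalProjections_closureProjection {H : Type*} [NormedAddCommGroup H]
    [InnerProductSpace ℂ H] [CompleteSpace H] {X : ℕ → Submodule ℂ H}
    (hX : Pairwise fun m n => X m ⟂ X n) : IsOrthogonalProjections (closureProjection X) := by
  refine ⟨fun n => isStarProjection_starProjection, fun m n hmn => ?_⟩
  refine Submodule.IsOrtho.starProjection_comp_starProjection ?_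
  rw [Submodule.isOrtho_iff_le, Submodule.orthogonal_closure]
  exact Submodule.topologicalClosure_minimal _ (hX hmn) (Submodule.isClosed_orthogonal _)

lemma closureProjection_eq_self {H : Type*} [NormedAddCommGroup H]
    [InnerProductSpace ℂ H] [CompleteSpace H] {X : ℕ → Submodule ℂ H} {n : ℕ} {x : H}
    (hx : x ∈ X n) : closureProjection X n x = x :=
  Submodule.starProjection_eq_self_iff.mpr (Submodule.le_topologicalClosure _ hx)

lemma closureProjection_eq_zero {H : Type*} [NormedAddCommGroup H]
    [InnerProductSpace ℂ H] [CompleteSpace H] {X : ℕ → Submodule ℂ H}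
    (hX : Pairwise fun m n => X m ⟂ X n) {m n : ℕ} (hmn : m ≠ n) {x : H}
    (hx : x ∈ X n) : closureProjection X m x = 0 := by
  have h : closureProjection X m (closureProjection X n x) = 0 :=
    DFunLike.congr_fun ((isOrthogonalProjections_closureProjection hX).2 hmn) x
  rwa [closureProjection_eq_self hx] at h

lemma inner_closureProjection {H : Type*} [NormedAddCommGroup H]
    [InnerProductSpace ℂ H] [CompleteSpace H] {X : ℕ → Submodule ℂ H} (n : ℕ) (x z : H) :
    inner ℂ x (closureProjection X n z) = inner ℂ (closureProjection X n x) z :=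
  (Submodule.inner_starProjection_left_eq_right _ x z).symm

variable {U : Submodule ℂ (H₁ →L[ℂ] H₂)} {X : ℕ → Submodule ℂ H₁} {Y : ℕ → Submodule ℂ H₂}

lemma IsRankOneDecomposition.Ref_subset_blockSum (h : IsRankOneDecomposition U X Y) :
    Ref {R | R ∈ U ∧ IsRankOne R} ⊆ blockSum (closureProjection Y) (closureProjection X) := by
  intro T hT
  have hF := isOrthogonalProjections_closureProjection h.orthoY
  -- A closed subspace contains T z once it contains the values at z of the rank one operators in
  -- the blocks, so each property of T is checked on those.
  have hmin : ∀ (z : H₁) (K : Submodule ℂ H₂), IsClosed (K : Set H₂) →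
      (∀ n, ∀ x ∈ X n, ∀ y ∈ Y n, inner ℂ x z • y ∈ K) → T z ∈ K := fun z K hK hz => by
    refine Submodule.topologicalClosure_minimal _ (Submodule.span_le.mpr ?_) hK (hT z)
    rintro _ ⟨S, ⟨hS, y, x, hy, hx, rfl⟩, rfl⟩
    obtain ⟨n, hxn, hyn⟩ := h.exists_mem x y hx hy hS
    exact hz n x hxn y hyn
  have hcomm : ∀ n, closureProjection Y n ∘L T = T ∘L closureProjection X n := fun n => by
    ext x
    have h1 : T (x - closureProjection X n x) ∈ (closureProjection Y n).ker := by
      refine hmin _ _ (closureProjection Y n).isClosed_ker fun m u hu v hv => ?_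
      rw [LinearMap.mem_ker]
      rcases eq_or_ne n m with rfl | hnm
      · simp [inner_closureProjection, closureProjection_eq_self hu]
      · simp [closureProjection_eq_zero h.orthoY hnm hv]
    have h2 : T (closureProjection X n x) ∈ (Y n).topologicalClosure := by
      refine hmin _ _ (Submodule.isClosed_topologicalClosure _) fun m u hu v hv => ?_
      rcases eq_or_ne n m with rfl | hnm
      · exact Submodule.smul_mem _ _ (Submodule.le_topologicalClosure _ hv)
      · simp [inner_closureProjection, closureProjection_eq_zero h.orthoX hnm hu]
    have h3 : closureProjection Y n (T (closureProjection X n x)) = T (closureProjection X n x) :=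
      Submodule.starProjection_eq_self_iff.mpr h2
    have h4 : closureProjection Y n (T (x - closureProjection X n x)) = 0 := h1
    rw [map_sub, map_sub, h3, sub_eq_zero] at h4
    exact h4
  refine mem_blockSum_of_hasSum hcomm hF fun x => ?_
  -- The vectors recovered by ∑ F n form a closed subspace containing every Y n.
  let K : Submodule ℂ H₂ :=
    { carrier := {v | HasSum (fun n => closureProjection Y n v) v}
      zero_mem' := by simp
      add_mem' := fun {a b} ha hb => by simpa using HasSum.add ha hb
      smul_mem' := fun c a ha => by simpa using HasSum.const_smul c ha }
  refine hmin x K (isClosed_setOf_hasSum_projections hF.1 hF.2) fun n u _ v hv =>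
    K.smul_mem _ ?_
  have := hasSum_single (f := fun m => closureProjection Y m v) n
    fun m hm => closureProjection_eq_zero h.orthoY hm hv
  rwa [closureProjection_eq_self hv] at this

/-- The ultraweak closure is norm closed and `rankOne` is norm continuous in each variable, so first
y and then x may pass to the limit. -/
lemma IsRankOneDecomposition.rankOne_mem_ultraweakClosure (h : IsRankOneDecomposition U X Y)
    {n : ℕ} {x : H₁} {y : H₂} (hx : x ∈ (X n).topologicalClosure)
    (hy : y ∈ (Y n).topologicalClosure) :
    rankOne ℂ y x ∈ ultraweakClosure (rankOneSubspace U : Set (H₁ →L[ℂ] H₂)) := by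
  have h0 : ∀ x ∈ X n, ∀ y ∈ Y n,
      rankOne ℂ y x ∈ ultraweakClosure (rankOneSubspace U : Set (H₁ →L[ℂ] H₂)) :=
    fun x hx y hy => subset_ultraweakClosure _ <| by
      by_cases hx0 : x = 0
      · simp [hx0]
      by_cases hy0 : y = 0
      · simp [hy0]
      exact Submodule.subset_span ⟨h.rankOne_mem n x hx y hy, y, x, hy0, hx0, rfl⟩
  have h1 : ∀ x ∈ X n, ∀ y ∈ (Y n).topologicalClosure,
      rankOne ℂ y x ∈ ultraweakClosure (rankOneSubspace U : Set (H₁ →L[ℂ] H₂)) :=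
    fun x hx => closure_minimal (t := {y | rankOne ℂ y x ∈ ultraweakClosure _}) (h0 x hx)
      ((isClosed_ultraweakClosure _).preimage (by fun_prop))
  exact closure_minimal (t := {x | rankOne ℂ y x ∈ ultraweakClosure _})
    (fun x hx => h1 x hx y hy)
    ((isClosed_ultraweakClosure _).preimage (by fun_prop)) hx

/-- Expand T = ∑ T E n, and T E n = ∑ (T b i)⊗(b i) over a Hilbert basis of the closure of X n. The
intertwining relation puts T b i in the closure of Y n. -/
lemma IsRankOneDecomposition.blockSum_subset_ultraweakClosure
    (h : IsRankOneDecomposition U X Y) :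
    blockSum (closureProjection Y) (closureProjection X) ⊆
      ultraweakClosure (rankOneSubspace U : Set (H₁ →L[ℂ] H₂)) := by
  intro T hT
  have hE := isOrthogonalProjections_closureProjection h.orthoX
  have hF := isOrthogonalProjections_closureProjection h.orthoY
  refine mem_ultraweakClosure_of_hasSum hE.1 hE.2 (hasSum_of_mem_blockSum hE hF hT) fun n => ?_
  obtain ⟨w, b, -⟩ := exists_hilbertBasis ℂ (X n).topologicalClosure
  have hb : ∀ i, closureProjection X n (b i) = (b i : H₁) := fun i =>
    Submodule.starProjection_eq_self_iff.mpr (b i).2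
  have hinner : ∀ i j, i ≠ j → inner ℂ (b i : H₁) (b j : H₁) = 0 := fun i j hij =>
    b.orthonormal.2 hij
  refine mem_ultraweakClosure_of_hasSum (P := fun i => rankOne ℂ (b i : H₁) (b i : H₁))
    (fun i => isStarProjection_rankOne_self (b.orthonormal.1 i)) (fun i j hij => ?_)
    (fun x => ?_) fun i => ?_
  · change rankOne ℂ (b i : H₁) (b i : H₁) ∘L rankOne ℂ (b j : H₁) (b j : H₁) = 0
    rw [rankOne_comp_rankOne, hinner i j hij, zero_smul]
  · have hs : HasSum (fun i => T (inner ℂ (b i : H₁) x • (b i : H₁)))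
        (T (closureProjection X n x)) := ((b.hasSum_orthogonalProjectionOnto x).mapL
      (X n).topologicalClosure.subtypeL).mapL T
    simpa [hb] using hs
  · rw [comp_rankOne]
    refine h.rankOne_mem_ultraweakClosure (b i).2 ?_
    have h1 : closureProjection Y n (T (b i)) = T (closureProjection X n (b i)) :=
      DFunLike.congr_fun (comp_eq_comp_of_mem_blockSum hE hF hT n) _
    rw [comp_apply, ← h1]
    exact Submodule.starProjection_apply_mem _ _

lemma IsRankOneDecomposition.Ref_eq_blockSum (h : IsRankOneDecomposition U X Y) :
    Ref {R | R ∈ U ∧ IsRankOne R} = blockSum (closureProjection Y) (closureProjection X) :=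
  h.Ref_subset_blockSum.antisymm
    (h.blockSum_subset_ultraweakClosure.trans (ultraweakClosure_span_subset_Ref _))

lemma IsRankOneDecomposition.ultraweakClosure_eq_blockSum (h : IsRankOneDecomposition U X Y) :
    ultraweakClosure (rankOneSubspace U : Set (H₁ →L[ℂ] H₂)) =
      blockSum (closureProjection Y) (closureProjection X) :=
  ((ultraweakClosure_span_subset_Ref _).trans h.Ref_subset_blockSum).antisymm
    h.blockSum_subset_ultraweakClosure

end Decomposition

/-! ### Constructing the blocks of a normalizing space -/

section Existence

variable {U : Submodule ℂ (H₁ →L[ℂ] H₂)}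

/-- A normalizing space contains `rankOne ℂ y x` as soon as it contains the operators obtained
from a chain of nonorthogonal vectors joining `y` to `x`. -/
lemma IsNormalizing.rankOne_mem (hU : IsNormalizing U) {x₁ x₂ x₃ : H₁} {y₁ y₂ y₃ : H₂}
    (h₁ : rankOne ℂ y₁ x₁ ∈ U) (h₂ : rankOne ℂ y₂ x₂ ∈ U) (h₃ : rankOne ℂ y₃ x₃ ∈ U)
    (hx : inner ℂ x₁ x₂ ≠ 0) (hy : inner ℂ y₂ y₃ ≠ 0) : rankOne ℂ y₁ x₃ ∈ U := by
  have h := hU _ h₁ _ h₂ _ h₃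
  rw [adjoint_rankOne, rankOne_comp_rankOne, comp_smul, rankOne_comp_rankOne] at h
  rwa [Submodule.smul_mem_iff _ hy, Submodule.smul_mem_iff _ hx] at h

/-- The subspace of all `x` such that `U` contains the operator `rankOne ℂ y x`. -/
def rightSpace (U : Submodule ℂ (H₁ →L[ℂ] H₂)) (y : H₂) : Submodule ℂ H₁ where
  carrier := {x | rankOne ℂ y x ∈ U}
  zero_mem' := by simp
  add_mem' := fun {a b} ha hb => by
    simpa using add_mem (show rankOne ℂ y a ∈ U from ha) (show rankOne ℂ y b ∈ U from hb)
  smul_mem' := fun c a ha => by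
    simpa [map_smulₛₗ] using U.smul_mem (starRingEnd ℂ c) (show rankOne ℂ y a ∈ U from ha)

/-- The subspace of all `y` such that `U` contains `rankOne ℂ y x` for every `x ∈ V`. -/
def leftSpace (U : Submodule ℂ (H₁ →L[ℂ] H₂)) (V : Submodule ℂ H₁) : Submodule ℂ H₂ where
  carrier := {y | ∀ x ∈ V, rankOne ℂ y x ∈ U}
  zero_mem' := by simp
  add_mem' := fun {a b} ha hb x hx => by simpa using add_mem (ha x hx) (hb x hx)
  smul_mem' := fun c a ha x hx => by simpa using U.smul_mem c (ha x hx)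

/-- The nonzero subspaces `rightSpace U y` with `y ≠ 0`. -/
def rightSpaces (U : Submodule ℂ (H₁ →L[ℂ] H₂)) : Set (Submodule ℂ H₁) :=
  {V | V ≠ ⊥ ∧ ∃ y, y ≠ 0 ∧ V = rightSpace U y}

lemma IsNormalizing.rightSpace_le (hU : IsNormalizing U) {y₁ y₂ : H₂} (hy₁ : y₁ ≠ 0) {x : H₁}
    (hx : x ≠ 0) (h₁ : x ∈ rightSpace U y₁) (h₂ : x ∈ rightSpace U y₂) :
    rightSpace U y₁ ≤ rightSpace U y₂ := fun _ hz =>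
  hU.rankOne_mem h₂ h₁ hz (inner_self_ne_zero.mpr hx) (inner_self_ne_zero.mpr hy₁)

lemma IsNormalizing.rightSpaces_eq (hU : IsNormalizing U) {V W : Submodule ℂ H₁}
    (hV : V ∈ rightSpaces U) (hW : W ∈ rightSpaces U) {x : H₁} (hx : x ≠ 0) (hxV : x ∈ V)
    (hxW : x ∈ W) : V = W := by
  obtain ⟨-, y₁, hy₁, rfl⟩ := hV
  obtain ⟨-, y₂, hy₂, rfl⟩ := hW
  exact (hU.rightSpace_le hy₁ hx hxV hxW).antisymm (hU.rightSpace_le hy₂ hx hxW hxV)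

lemma IsNormalizing.isOrtho_rightSpaces (hU : IsNormalizing U) {V W : Submodule ℂ H₁}
    (hV : V ∈ rightSpaces U) (hW : W ∈ rightSpaces U) (hVW : V ≠ W) : V ⟂ W := by
  rw [Submodule.isOrtho_iff_inner_eq]
  intro x hx z hz
  by_contra hxz
  have hz0 : z ≠ 0 := fun h => hxz (by simp [h])
  obtain ⟨-, y₁, hy₁, hV'⟩ := id hV
  obtain ⟨-, y₂, hy₂, hW'⟩ := id hW
  refine hVW (hU.rightSpaces_eq hV hW hz0 ?_ hz)
  rw [hV'] at hx ⊢
  rw [hW'] at hz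
  -- The chain y₁⊗x, y₂⊗z, y₂⊗z gives y₁⊗z ∈ U, so z is common to V and W.
  exact hU.rankOne_mem hx hz hz hxz (inner_self_ne_zero.mpr hy₂)

lemma IsNormalizing.isOrtho_leftSpace (hU : IsNormalizing U) {V W : Submodule ℂ H₁}
    (hV : V ∈ rightSpaces U) (hW : W ∈ rightSpaces U) (hVW : V ≠ W) :
    leftSpace U V ⟂ leftSpace U W := by
  rw [Submodule.isOrtho_iff_inner_eq]
  intro y hy z hz
  by_contra hyz
  obtain ⟨hV0, y₁, hy₁, hV'⟩ := id hV
  obtain ⟨x, hx, hx0⟩ := Submodule.exists_mem_ne_zero_of_ne_bot hV0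
  obtain ⟨w, hw, hw0⟩ := Submodule.exists_mem_ne_zero_of_ne_bot hW.1
  refine hVW (hU.rightSpaces_eq hV hW hw0 ?_ hw)
  have hy₁x : rankOne ℂ y₁ x ∈ U := by
    rw [hV'] at hx
    exact hx
  rw [hV']
  -- The chain y₁⊗x, y⊗x, z⊗w gives y₁⊗w ∈ U, so w is common to V and W.
  exact hU.rankOne_mem hy₁x (hy x hx) (hz w hw) (inner_self_ne_zero.mpr hx0) hyz

/-- In a separable Hilbert space, a family of pairwise orthogonal nonzero subspaces is countable. -/
lemma countable_of_pairwise_isOrtho {H : Type*} [NormedAddCommGroup H] [InnerProductSpace ℂ H]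
    [TopologicalSpace.SeparableSpace H] {𝒱 : Set (Submodule ℂ H)} (h0 : ∀ V ∈ 𝒱, V ≠ ⊥)
    (h : ∀ V ∈ 𝒱, ∀ W ∈ 𝒱, V ≠ W → V ⟂ W) : 𝒱.Countable := by
  have hu : ∀ V : Submodule ℂ H, ∃ u ∈ V, V ≠ ⊥ → ‖u‖ = 1 := fun V => by
    by_cases hV : V = ⊥
    · exact ⟨0, V.zero_mem, fun h => (h hV).elim⟩
    obtain ⟨x, hx, hx0⟩ := Submodule.exists_mem_ne_zero_of_ne_bot hV
    exact ⟨((‖x‖⁻¹ : ℝ) : ℂ) • x, V.smul_mem _ hx, fun _ => by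
      simp [norm_smul, inv_mul_cancel₀ (norm_ne_zero_iff.mpr hx0)]⟩
  choose u hu hu1 using hu
  -- Orthogonal unit vectors are at distance √2 > 1, so balls of radius 1/2 about them are disjoint.
  refine Set.PairwiseDisjoint.countable_of_isOpen (s := fun V => Metric.ball (u V) (1 / 2))
    (fun V hV W hW hVW => ?_) (fun _ _ => Metric.isOpen_ball)
    fun V _ => ⟨u V, Metric.mem_ball_self (by norm_num)⟩
  refine Metric.ball_disjoint_ball ?_
  have horth : inner ℂ (u V) (u W) = 0 :=
    (Submodule.isOrtho_iff_inner_eq.mp (h V hV W hW hVW)) _ (hu V) _ (hu W)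
  have hd : ‖u V - u W‖ * ‖u V - u W‖ = ‖u V‖ * ‖u V‖ + ‖u W‖ * ‖u W‖ := by
    simpa [horth, sq] using norm_sub_sq (𝕜 := ℂ) (u V) (u W)
  rw [hu1 V (h0 V hV), hu1 W (h0 W hW)] at hd
  rw [dist_eq_norm]
  nlinarith [norm_nonneg (u V - u W)]

lemma IsNormalizing.exists_isRankOneDecomposition [TopologicalSpace.SeparableSpace H₁]
    (hU : IsNormalizing U) : ∃ (X : ℕ → Submodule ℂ H₁) (Y : ℕ → Submodule ℂ H₂),
      IsRankOneDecomposition U X Y := by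
  have hcount : (rightSpaces U).Countable :=
    countable_of_pairwise_isOrtho (fun V hV => hV.1) fun V hV W hW => hU.isOrtho_rightSpaces hV hW
  obtain ⟨f, hf⟩ := hcount.to_subtype.exists_injective_nat
  -- Indices outside the range of the enumeration `f` get ⊥, which is orthogonal to everything.
  let X : ℕ → Submodule ℂ H₁ := Function.extend f (fun V => V.1) fun _ => ⊥
  let Y : ℕ → Submodule ℂ H₂ := Function.extend f (fun V => leftSpace U V.1) fun _ => ⊥
  have hX : ∀ V, X (f V) = V.1 := fun V => hf.extend_apply _ _ V
  have hY : ∀ V, Y (f V) = leftSpace U V.1 := fun V => hf.extend_apply _ _ V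
  have hX0 : ∀ n, (¬∃ V, f V = n) → X n = ⊥ := fun n hn => Function.extend_apply' _ _ n hn
  have hY0 : ∀ n, (¬∃ V, f V = n) → Y n = ⊥ := fun n hn => Function.extend_apply' _ _ n hn
  refine ⟨X, Y, fun m n hmn => ?_, fun m n hmn => ?_, fun n x hx y hy => ?_,
    fun x y hx hy hxy => ?_⟩
  · by_cases hm : ∃ V, f V = m
    · by_cases hn : ∃ V, f V = n
      · obtain ⟨⟨V, rfl⟩, ⟨W, rfl⟩⟩ := And.intro hm hn
        rw [hX, hX]
        exact hU.isOrtho_rightSpaces V.2 W.2 fun h => hmn (congrArg f (Subtype.ext h))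
      · simp [hX0 n hn]
    · simp [hX0 m hm]
  · by_cases hm : ∃ V, f V = m
    · by_cases hn : ∃ V, f V = n
      · obtain ⟨⟨V, rfl⟩, ⟨W, rfl⟩⟩ := And.intro hm hn
        rw [hY, hY]
        exact hU.isOrtho_leftSpace V.2 W.2 fun h => hmn (congrArg f (Subtype.ext h))
      · simp [hY0 n hn]
    · simp [hY0 m hm]
  · by_cases hn : ∃ V, f V = n
    · obtain ⟨V, rfl⟩ := hn
      rw [hX] at hx
      rw [hY] at hy
      exact hy x hx
    · rw [hX0 n hn, Submodule.mem_bot] at hx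
      simp [hx]
  · have hxV : x ∈ rightSpace U y := hxy
    let V : rightSpaces U := ⟨rightSpace U y, (Submodule.ne_bot_iff _).mpr ⟨x, hxV, hx⟩, y, hy, rfl⟩
    exact ⟨f V, by rw [hX]; exact hxV, by rw [hY]; exact fun z hz => hz⟩

end Existence

/-- Enlarging the generating set to all rank one operators of U does not change the hull, because
the larger set still lies in it. -/
lemma IsStronglyReflexive.eq_Ref {U : Submodule ℂ (H₁ →L[ℂ] H₂)} (hU : IsStronglyReflexive U) :
    (U : Set (H₁ →L[ℂ] H₂)) = Ref {R | R ∈ U ∧ IsRankOne R} := by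
  obtain ⟨𝒮, h𝒮, hU⟩ := hU
  refine Set.Subset.antisymm ?_ ?_
  · rw [hU]
    exact Ref_mono fun S hS => ⟨by rw [← SetLike.mem_coe, hU]; exact subset_Ref 𝒮 hS, h𝒮 S hS⟩
  · rw [hU]
    exact Ref_subset_Ref_of_subset fun S hS => hU ▸ hS.1

end NormalizingSpaces

theorem theorem3p5 {H₁ H₂ : Type*}
    [NormedAddCommGroup H₁] [InnerProductSpace ℂ H₁] [CompleteSpace H₁]
    [TopologicalSpace.SeparableSpace H₁]
    [NormedAddCommGroup H₂] [InnerProductSpace ℂ H₂] [CompleteSpace H₂]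
    [TopologicalSpace.SeparableSpace H₂] :
    (∀ U : Submodule ℂ (H₁ →L[ℂ] H₂), NormalizingSpaces.IsStronglyReflexive U →
      (NormalizingSpaces.IsNormalizing U ↔
        ∃ (E : ℕ → H₁ →L[ℂ] H₁) (F : ℕ → H₂ →L[ℂ] H₂),
          NormalizingSpaces.IsOrthogonalProjections E ∧
          NormalizingSpaces.IsOrthogonalProjections F ∧
          (U : Set (H₁ →L[ℂ] H₂)) = NormalizingSpaces.blockSum F E)) ∧
    (∀ U : Submodule ℂ (H₁ →L[ℂ] H₂), NormalizingSpaces.IsNormalizing U →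
      ∃ (E : ℕ → H₁ →L[ℂ] H₁) (F : ℕ → H₂ →L[ℂ] H₂),
        NormalizingSpaces.IsOrthogonalProjections E ∧
        NormalizingSpaces.IsOrthogonalProjections F ∧
        NormalizingSpaces.ultraweakClosure
            (NormalizingSpaces.rankOneSubspace U : Set (H₁ →L[ℂ] H₂)) =
          NormalizingSpaces.blockSum F E) := by
  refine ⟨fun U hU => ⟨fun hN => ?_, ?_⟩, fun U hN => ?_⟩
  · obtain ⟨X, Y, h⟩ := hN.exists_isRankOneDecomposition
    exact ⟨_, _, NormalizingSpaces.isOrthogonalProjections_closureProjection h.orthoX,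
      NormalizingSpaces.isOrthogonalProjections_closureProjection h.orthoY,
      hU.eq_Ref.trans h.Ref_eq_blockSum⟩
  · rintro ⟨E, F, hE, hF, hEF⟩
    exact NormalizingSpaces.isNormalizing_of_eq_blockSum hE hF hEF
  · obtain ⟨X, Y, h⟩ := hN.exists_isRankOneDecomposition
    exact ⟨_, _, NormalizingSpaces.isOrthogonalProjections_closureProjection h.orthoX,
      NormalizingSpaces.isOrthogonalProjections_closureProjection h.orthoY,
      h.ultraweakClosure_eq_blockSum⟩
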